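/- All Hilbert spaces are complex; an operator is a bounded linear map of a Hilbert space into itself, and a contraction is an operator $T$ with $\|T\|\le 1$. An operator $T$ on $H$ is *weakly stable* if $\langle T^n x, z\rangle\to 0$ for all $x,z\in H$. It is *weakly l-sequentially supercyclic* if there is a nonzero $y\in H$ such that for every $x\in H$ there are nonzero scalars $\alpha_i\in\mathbb C$ and integers $0\le n_0<n_1<n_2<\cdots$ with $\alpha_i T^{n_i}y\to x$ weakly. A closed subspace $\mathcal M$ *reduces* $T$ if $\mathcal M$ and $\mathcal M^\perp$ are both $T$-invariant; $T$ is *completely nonunitary* if no restriction of $T$ to a nonzero closed reducing subspace is unitary. (1) Let $T$ be a contraction on a Hilbert space $H$ (of any dimension). (a) (Nagy–Foiaş–Langer decomposition.) There is exactly one closed subspace $\mathcal U\subseteq H$ that reduces $T$ and is such that $U=T|_{\mathcal U}$ is unitary and $C=T|_{\mathcal U^\perp}$ is a completely nonunitary contraction (either subspace may be $\{0\}$). The operator $U$ is called the unitary part of $T$. (b) If $T$ is completely nonunitary, then $T$ is weakly stable. (c) $T$ is not weakly stable if and only if $\mathcal U\neq\{0\}$ and $U$ is not weakly stable; and in this case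 $\|T\|=\|U\|=1$. (2) The following two assertions are equivalent: (i) every weakly l-sequentially supercyclic contraction on an infinite-dimensional Hilbert space is weakly stable; (ii) every weakly l-sequentially supercyclic unitary operator on an infinite-dimensional Hilbert space is weakly stable. -/

import Mathlib

open Filter Topology

namespace WeakDynamics

variable {H : Type*} [NormedAddCommGroup H] [InnerProductSpace ℂ H]

/-- Weak convergence `x n ⇀ a` of a sequence in an inner product space. -/
def WeaklyTendsto (x : ℕ → H) (a : H) : Prop :=
  ∀ z : H, Tendsto (fun n => inner ℂ z (x n)) atTop (𝓝 (inner ℂ z a))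

/-- `T` is weakly stable: `T ^ n x ⇀ 0` for every `x`. -/
def WeaklyStable (T : H →L[ℂ] H) : Prop :=
  ∀ x : H, WeaklyTendsto (fun n => (T ^ n) x) 0

/-- `y` is a weakly l-sequentially supercyclic vector for `T`: it is nonzero, and every `x` is the
weak limit of `α i • T ^ (n i) y` for some sequence `α` of nonzero scalars and some strictly
increasing sequence `n` of exponents. -/
def IsWeaklyLSeqSupercyclicVector (T : H →L[ℂ] H) (y : H) : Prop :=
  y ≠ 0 ∧ ∀ x : H, ∃ α : ℕ → ℂ, (∀ i, α i ≠ 0) ∧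
    ∃ n : ℕ → ℕ, StrictMono n ∧ WeaklyTendsto (fun i => α i • (T ^ n i) y) x

/-- `T` is weakly l-sequentially supercyclic. -/
def WeaklyLSeqSupercyclic (T : H →L[ℂ] H) : Prop :=
  ∃ y : H, IsWeaklyLSeqSupercyclicVector T y

/-- `U` is unitary: `U U* = U* U = I`. -/
def IsUnitary [CompleteSpace H] (U : H →L[ℂ] H) : Prop :=
  U ∈ unitary (H →L[ℂ] H)

/-- The subspace `M` reduces `T`: both `M` and its orthogonal complement are `T`-invariant. -/
structure Reduces (T : H →L[ℂ] H) (M : Submodule ℂ H) : Prop where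
  mapsTo : Set.MapsTo T M M
  mapsTo_orthogonal : Set.MapsTo T Mᗮ Mᗮ

/-- `T` is completely nonunitary: the restriction of `T` to a nonzero closed reducing subspace is
never unitary. (A subspace of a Hilbert space is complete iff it is closed.) -/
def CompletelyNonunitary (T : H →L[ℂ] H) : Prop :=
  ∀ (M : Submodule ℂ H) [CompleteSpace M] (hM : Reduces T M),
    IsUnitary (T.restrict hM.mapsTo) → M = ⊥

/-- `M` is a closed subspace that reduces `T`, the part of `T` on `M` is unitary and the part of
`T` on `Mᗮ` is a completely nonunitary contraction, so that `T = T|Mᗮ ⊕ T|M` is a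
Nagy–Foiaş–Langer decomposition of `T` and `T|M` is the unitary part of `T`. -/
structure IsUnitarySubspace (T : H →L[ℂ] H) (M : Submodule ℂ H) [CompleteSpace M] : Prop where
  reduces : Reduces T M
  isUnitary : IsUnitary (T.restrict reduces.mapsTo)
  norm_le_one : ‖T.restrict reduces.mapsTo_orthogonal‖ ≤ 1
  completelyNonunitary : CompletelyNonunitary (T.restrict reduces.mapsTo_orthogonal)

end WeakDynamics

open WeakDynamics

universe u

namespace WeakDynamics

variable {H : Type*} [NormedAddCommGroup H] [InnerProductSpace ℂ H]

/-! ### Restrictions to invariant subspaces -/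

/-! For a contraction, `‖T x‖ = ‖x‖` forces `T* T x = x`. Hence the vectors fixed by all `T*ⁿ Tⁿ`
and `Tⁿ T*ⁿ` form a closed reducing subspace containing every subspace that `T` maps isometrically
onto itself. This maximality gives the decomposition and its uniqueness.

Since `‖Tⁿ x‖` decreases to a limit, `T*ᵏ Tᵏ` is asymptotically the identity along the orbit of `x`,
so all weak limit points of the orbit lie in the unitary subspace
(`weak_limit_mem_unitarySubspace`). If that subspace is zero, the orbit tends weakly to 0; in
general stability is decided on the unitary part.

For (2), supercyclicity passes to the unitary part by projection. A nonzero finite-dimensional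
unitary part is the one obstruction, and it would make the whole space finite-dimensional. -/

theorem coe_restrict_pow (T : H →L[ℂ] H) {M : Submodule ℂ H} (h : Set.MapsTo T M M) (n : ℕ)
    (x : M) : (((T.restrict h) ^ n) x : H) = (T ^ n) x := by
  induction n generalizing x with
  | zero => simp
  | succ n ih => rw [pow_succ, pow_succ]; exact ih _

theorem pow_add_apply (T : H →L[ℂ] H) (m n : ℕ) (x : H) :
    (T ^ (m + n)) x = (T ^ m) ((T ^ n) x) := by
  rw [pow_add]; rfl

theorem pow_succ_apply (T : H →L[ℂ] H) (n : ℕ) (x : H) :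
    (T ^ (n + 1)) x = (T ^ n) (T x) := by
  rw [pow_succ]; rfl

theorem pow_succ_apply' (T : H →L[ℂ] H) (n : ℕ) (x : H) :
    (T ^ (n + 1)) x = T ((T ^ n) x) := by
  rw [pow_succ']; rfl

theorem norm_restrict_le (T : H →L[ℂ] H) {M : Submodule ℂ H} (h : Set.MapsTo T M M) :
    ‖T.restrict h‖ ≤ ‖T‖ :=
  ContinuousLinearMap.opNorm_le_bound _ (norm_nonneg _) fun x => T.le_opNorm (x : H)

theorem norm_pow_apply_le {T : H →L[ℂ] H} (hT : ‖T‖ ≤ 1) (n : ℕ) (x : H) :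
    ‖(T ^ n) x‖ ≤ ‖x‖ := by
  induction n generalizing x with
  | zero => simp
  | succ n ih =>
    rw [pow_succ]
    exact (ih (T x)).trans (T.le_of_opNorm_le hT x |>.trans_eq (one_mul _))

theorem isUnitary_iff_norm_map_and_surjective [CompleteSpace H] (V : H →L[ℂ] H) :
    IsUnitary V ↔ (∀ x, ‖V x‖ = ‖x‖) ∧ Function.Surjective V := by
  unfold IsUnitary
  rw [Unitary.mem_iff, ContinuousLinearMap.star_eq_adjoint]
  constructor
  · rintro ⟨h₁, h₂⟩
    refine ⟨(ContinuousLinearMap.norm_map_iff_adjoint_comp_self V).2 h₁, fun x => ?_⟩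
    exact ⟨V.adjoint x, by simpa using congrArg (fun A : H →L[ℂ] H => A x) h₂⟩
  · rintro ⟨h₁, h₂⟩
    have h := (ContinuousLinearMap.norm_map_iff_adjoint_comp_self V).1 h₁
    refine ⟨h, ?_⟩
    ext x
    obtain ⟨w, rfl⟩ := h₂ x
    have hw : V.adjoint (V w) = w := by simpa using congrArg (fun A : H →L[ℂ] H => A w) h
    simp [hw]

theorem isUnitary_restrict_iff (T : H →L[ℂ] H) {M : Submodule ℂ H} [CompleteSpace M]
    (h : Set.MapsTo T M M) :
    IsUnitary (T.restrict h) ↔ (∀ x ∈ M, ‖T x‖ = ‖x‖) ∧ ∀ x ∈ M, ∃ w ∈ M, T w = x := by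
  rw [isUnitary_iff_norm_map_and_surjective]
  constructor
  · rintro ⟨h₁, h₂⟩
    refine ⟨fun x hx => h₁ ⟨x, hx⟩, fun x hx => ?_⟩
    obtain ⟨w, hw⟩ := h₂ ⟨x, hx⟩
    exact ⟨w, w.2, congrArg Subtype.val hw⟩
  · rintro ⟨h₁, h₂⟩
    refine ⟨fun x => h₁ x x.2, fun x => ?_⟩
    obtain ⟨w, hw, hx⟩ := h₂ x x.2
    exact ⟨⟨w, hw⟩, Subtype.ext hx⟩

/-! ### Weak convergence and invariant subspaces -/

theorem weaklyStable_restrict_iff (T : H →L[ℂ] H) {M : Submodule ℂ H} [CompleteSpace M]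
    (h : Set.MapsTo T M M) :
    WeaklyStable (T.restrict h) ↔ ∀ x ∈ M, WeaklyTendsto (fun n => (T ^ n) x) 0 := by
  have key (x : M) (n : ℕ) (z : H) : inner ℂ z ((T ^ n) (x : H)) =
      inner ℂ (M.orthogonalProjectionOnto z) (((T.restrict h) ^ n) x) := by
    rw [← coe_restrict_pow T h, Submodule.inner_orthogonalProjectionOnto_eq_of_mem_right]
  constructor
  · intro hs x hx z
    have h₀ := hs ⟨x, hx⟩ (M.orthogonalProjectionOnto z)
    simp only [← key ⟨x, hx⟩, inner_zero_right] at h₀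
    simpa only [inner_zero_right] using h₀
  · intro hs x z
    have h₀ := hs x x.2 z
    simp only [← coe_restrict_pow T h, inner_zero_right] at h₀
    simpa only [inner_zero_right] using! h₀

theorem WeaklyTendsto.add {x y : ℕ → H} {a b : H} (hx : WeaklyTendsto x a)
    (hy : WeaklyTendsto y b) : WeaklyTendsto (fun n => x n + y n) (a + b) := fun z => by
  simpa [inner_add_right] using (hx z).add (hy z)

theorem weaklyStable_iff_of_reduces {T : H →L[ℂ] H} {M : Submodule ℂ H} [CompleteSpace M]
    [CompleteSpace Mᗮ] (h : Reduces T M) :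
    WeaklyStable T ↔
      WeaklyStable (T.restrict h.mapsTo) ∧ WeaklyStable (T.restrict h.mapsTo_orthogonal) := by
  rw [weaklyStable_restrict_iff, weaklyStable_restrict_iff]
  refine ⟨fun hs => ⟨fun x _ => hs x, fun x _ => hs x⟩, fun ⟨h₁, h₂⟩ x => ?_⟩
  obtain ⟨p, hp, q, hq, rfl⟩ := M.exists_add_mem_mem_orthogonal x
  simpa using (h₁ p hp).add (h₂ q hq)

/-- Closed discs in `ℂ` are compact, so each scalar sequence converges along `F`; Riesz
representation turns the limits into a vector. Ultrafilters avoid extracting subsequences. -/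
theorem exists_weak_limit_of_bounded [CompleteSpace H] (F : Ultrafilter ℕ) {x : ℕ → H} {c : ℝ}
    (hx : ∀ n, ‖x n‖ ≤ c) :
    ∃ y : H, ∀ z, Tendsto (fun n => inner ℂ z (x n)) F (𝓝 (inner ℂ z y)) := by
  -- The inner product is linear in its second slot, so `z` is placed there; conjugation restores
  -- the order at the end.
  have hb (z : H) (n : ℕ) : inner ℂ (x n) z ∈ Metric.closedBall (0 : ℂ) (c * ‖z‖) := by
    rw [mem_closedBall_zero_iff]
    exact (norm_inner_le_norm _ _).trans (mul_le_mul_of_nonneg_right (hx n) (norm_nonneg _))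
  have hlim (z : H) : ∃ l ∈ Metric.closedBall (0 : ℂ) (c * ‖z‖),
      Tendsto (fun n => inner ℂ (x n) z) F (𝓝 l) :=
    (isCompact_closedBall (0 : ℂ) (c * ‖z‖)).ultrafilter_le_nhds
      (F.map fun n => inner ℂ (x n) z) (by
        rw [Ultrafilter.coe_map, le_principal_iff]
        exact mem_map.2 (Eventually.of_forall (hb z)))
  choose l hl htends using hlim
  let f : H →L[ℂ] ℂ := LinearMap.mkContinuous
    { toFun := l
      map_add' := fun a b => tendsto_nhds_unique (htends (a + b))
        (by simpa [inner_add_right] using (htends a).add (htends b))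
      map_smul' := fun r a => tendsto_nhds_unique (htends (r • a))
        (by simpa [inner_smul_right] using (htends a).const_mul r) }
    c fun z => by simpa using hl z
  refine ⟨(InnerProductSpace.toDual ℂ H).symm f, fun z => ?_⟩
  rw [← inner_conj_symm, InnerProductSpace.toDual_symm_apply]
  refine ((Complex.continuous_conj.tendsto _).comp (htends z)).congr fun n => ?_
  exact inner_conj_symm _ _

theorem WeaklyTendsto.orthogonalProjection {x : ℕ → H} {a : H} (hx : WeaklyTendsto x a)
    (M : Submodule ℂ H) [CompleteSpace M] :
    WeaklyTendsto (fun n => M.orthogonalProjectionOnto (x n)) (M.orthogonalProjectionOnto a) := by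
  intro z
  simpa only [Submodule.inner_orthogonalProjectionOnto_eq_of_mem_left] using hx z

theorem IsUnitary.norm_eq_one [CompleteSpace H] [Nontrivial H] {U : H →L[ℂ] H} (hU : IsUnitary U) : ‖U‖ = 1 :=
  CStarRing.norm_of_mem_unitary hU

theorem ne_bot_of_not_weaklyStable_restrict {T : H →L[ℂ] H} {M : Submodule ℂ H}
    {h : Set.MapsTo T M M} (hs : ¬ WeaklyStable (T.restrict h)) : M ≠ ⊥ := by
  rintro rfl
  refine hs fun x z => ?_
  rw [Subsingleton.elim z 0]
  simp

theorem IsUnitarySubspace.norm_eq_one {T : H →L[ℂ] H} (hT : ‖T‖ ≤ 1) {M : Submodule ℂ H}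
    [CompleteSpace M] (hM : IsUnitarySubspace T M) (hne : M ≠ ⊥) :
    ‖T‖ = 1 ∧ ‖T.restrict hM.reduces.mapsTo‖ = 1 := by
  have : Nontrivial M := Submodule.nontrivial_iff_ne_bot.2 hne
  have h := IsUnitary.norm_eq_one hM.isUnitary
  exact ⟨le_antisymm hT (h ▸ norm_restrict_le T _), h⟩

/-! ### Supercyclicity and reducing subspaces -/

theorem pow_orthogonalProjection_of_reduces {T : H →L[ℂ] H} {M : Submodule ℂ H}
    [CompleteSpace M] (h : Reduces T M) (n : ℕ) (y : H) :
    M.orthogonalProjectionOnto ((T ^ n) y) =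
      ((T.restrict h.mapsTo) ^ n) (M.orthogonalProjectionOnto y) := by
  obtain ⟨p, hp, q, hq, rfl⟩ := M.exists_add_mem_mem_orthogonal y
  have h₁ : (T ^ n) p = (((T.restrict h.mapsTo) ^ n) ⟨p, hp⟩ : M) :=
    (coe_restrict_pow T h.mapsTo n ⟨p, hp⟩).symm
  have h₂ : (T ^ n) q ∈ Mᗮ := by
    have := (((T.restrict h.mapsTo_orthogonal) ^ n) ⟨q, hq⟩).2
    rwa [coe_restrict_pow] at this
  rw [map_add, map_add, map_add, h₁, Submodule.orthogonalProjectionOnto_mem_subspace_eq_self,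
    Submodule.orthogonalProjectionOnto_apply_of_mem_orthogonal h₂,
    Submodule.orthogonalProjectionOnto_apply_of_mem_orthogonal hq, add_zero, add_zero]
  congr 1
  exact (Submodule.orthogonalProjectionOnto_mem_subspace_eq_self (K := M) ⟨p, hp⟩).symm

theorem IsWeaklyLSeqSupercyclicVector.orthogonalProjection {T : H →L[ℂ] H} {y : H}
    (hy : IsWeaklyLSeqSupercyclicVector T y) {M : Submodule ℂ H} [CompleteSpace M]
    (h : Reduces T M) (hne : M ≠ ⊥) :
    IsWeaklyLSeqSupercyclicVector (T.restrict h.mapsTo) (M.orthogonalProjectionOnto y) := by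
  have key (x : M) : ∃ α : ℕ → ℂ, (∀ i, α i ≠ 0) ∧ ∃ n : ℕ → ℕ, StrictMono n ∧
      WeaklyTendsto (fun i => α i • ((T.restrict h.mapsTo) ^ n i) (M.orthogonalProjectionOnto y))
        x := by
    obtain ⟨α, hα, n, hn, hlim⟩ := hy.2 x
    refine ⟨α, hα, n, hn, ?_⟩
    have := hlim.orthogonalProjection M
    simpa only [map_smul, pow_orthogonalProjection_of_reduces h,
      Submodule.orthogonalProjectionOnto_mem_subspace_eq_self] using this
  refine ⟨fun h0 => hne ?_, key⟩
  rw [eq_bot_iff]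
  intro x hx
  obtain ⟨α, -, n, -, hlim⟩ := key ⟨x, hx⟩
  -- If the projection of `y` vanished, every `x` in `M` would be a weak limit of zeros; test
  -- against `x` itself.
  have := hlim ⟨x, hx⟩
  simp only [h0, map_zero, smul_zero, inner_zero_right] at this
  have h1 := tendsto_nhds_unique this tendsto_const_nhds
  exact congrArg Subtype.val (inner_self_eq_zero (𝕜 := ℂ).1 h1)

theorem WeaklyTendsto.tendsto_of_finiteDimensional {E : Type*} [NormedAddCommGroup E]
    [InnerProductSpace ℂ E] [FiniteDimensional ℂ E] {x : ℕ → E} {a : E}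
    (hx : WeaklyTendsto x a) : Tendsto x atTop (𝓝 a) := by
  let b := stdOrthonormalBasis ℂ E
  have h : Tendsto (fun n => ∑ i, inner ℂ (b i) (x n) • b i) atTop
      (𝓝 (∑ i, inner ℂ (b i) a • b i)) :=
    tendsto_finsetSum _ fun i _ => (hx (b i)).smul_const (b i)
  simpa only [b.sum_repr'] using h

/-! ### The unitary subspace of a contraction -/

section Complete

variable [CompleteSpace H]

open ContinuousLinearMap

/-- Expand the square: the cross term is `-2‖T x‖²`, and `‖T* T x‖ ≤ ‖T x‖`. -/
theorem norm_adjoint_apply_self_sub_sq_le {T : H →L[ℂ] H} (hT : ‖T‖ ≤ 1) (x : H) :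
    ‖T.adjoint (T x) - x‖ ^ 2 ≤ ‖x‖ ^ 2 - ‖T x‖ ^ 2 := by
  have h₁ : ‖T.adjoint (T x)‖ ≤ ‖T x‖ := by
    simpa using T.adjoint.le_of_opNorm_le (c := 1) (by simpa using hT) (T x)
  have h₂ : RCLike.re (inner ℂ (T.adjoint (T x)) x) = ‖T x‖ ^ 2 := by
    rw [adjoint_inner_left, inner_self_eq_norm_sq]
  have h₃ := norm_sub_sq (𝕜 := ℂ) (T.adjoint (T x)) x
  rw [h₂] at h₃
  have h₄ : ‖T.adjoint (T x)‖ ^ 2 ≤ ‖T x‖ ^ 2 := by gcongr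
  linarith

theorem adjoint_apply_self_of_norm_eq {T : H →L[ℂ] H} (hT : ‖T‖ ≤ 1) {x : H}
    (hx : ‖T x‖ = ‖x‖) : T.adjoint (T x) = x := by
  have h := norm_adjoint_apply_self_sub_sq_le hT x
  rw [hx, sub_self] at h
  exact sub_eq_zero.1 (norm_eq_zero.1 (pow_eq_zero_iff two_ne_zero |>.1
    (le_antisymm h (sq_nonneg _))))

/-- The vectors on which all powers of `T` and of its adjoint act as mutually inverse maps. -/
def unitarySubspace (T : H →L[ℂ] H) : Submodule ℂ H where
  carrier := {x | ∀ n : ℕ, (T.adjoint ^ n) ((T ^ n) x) = x ∧ (T ^ n) ((T.adjoint ^ n) x) = x}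
  add_mem' ha hb n := by
    simp only [map_add, (ha n).1, (hb n).1, (ha n).2, (hb n).2, and_self]
  zero_mem' n := by simp
  smul_mem' c x hx n := by simp only [map_smul, (hx n).1, (hx n).2, and_self]

theorem mem_unitarySubspace {T : H →L[ℂ] H} {x : H} : x ∈ unitarySubspace T ↔
    ∀ n : ℕ, (T.adjoint ^ n) ((T ^ n) x) = x ∧ (T ^ n) ((T.adjoint ^ n) x) = x := Iff.rfl

theorem adjoint_apply_of_mem {T : H →L[ℂ] H} {x : H} (hx : x ∈ unitarySubspace T) :
    T.adjoint (T x) = x := by simpa using (hx 1).1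

theorem apply_adjoint_of_mem {T : H →L[ℂ] H} {x : H} (hx : x ∈ unitarySubspace T) :
    T (T.adjoint x) = x := by simpa using (hx 1).2

theorem unitarySubspace_adjoint (T : H →L[ℂ] H) :
    unitarySubspace T.adjoint = unitarySubspace T := by
  ext x
  simp only [mem_unitarySubspace, adjoint_adjoint]
  exact forall_congr' fun _ => and_comm

instance completeSpace_unitarySubspace (T : H →L[ℂ] H) : CompleteSpace (unitarySubspace T) := by
  refine IsClosed.completeSpace_coe (s := (unitarySubspace T : Set H)) (hs := ?_)
  have : (unitarySubspace T : Set H) = ⋂ n : ℕ, {x | (T.adjoint ^ n) ((T ^ n) x) = x} ∩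
      {x | (T ^ n) ((T.adjoint ^ n) x) = x} := by
    ext x; simp [mem_unitarySubspace]
  rw [this]
  exact isClosed_iInter fun n => (isClosed_eq (by fun_prop) continuous_id).inter
    (isClosed_eq (by fun_prop) continuous_id)

theorem norm_apply_of_mem {T : H →L[ℂ] H} {x : H} (hx : x ∈ unitarySubspace T) :
    ‖T x‖ = ‖x‖ := by
  have h : inner ℂ (T x) (T x) = inner ℂ x x := by
    rw [← adjoint_inner_left, adjoint_apply_of_mem hx]
  rw [@norm_eq_sqrt_re_inner ℂ, @norm_eq_sqrt_re_inner ℂ _ _ _ _ x, h]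

/-- Every subspace that `T` maps isometrically onto itself lies in the unitary subspace. -/
theorem le_unitarySubspace {T : H →L[ℂ] H} (hT : ‖T‖ ≤ 1) {K : Submodule ℂ H}
    (hmap : Set.MapsTo T K K) (hnorm : ∀ x ∈ K, ‖T x‖ = ‖x‖)
    (hsurj : ∀ x ∈ K, ∃ w ∈ K, T w = x) : K ≤ unitarySubspace T := by
  have h₁ : ∀ x ∈ K, T.adjoint (T x) = x := fun x hx =>
    adjoint_apply_self_of_norm_eq hT (hnorm x hx)
  have h₂ : ∀ x ∈ K, T.adjoint x ∈ K ∧ T (T.adjoint x) = x := by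
    intro x hx
    obtain ⟨w, hw, rfl⟩ := hsurj x hx
    rw [h₁ w hw]
    exact ⟨hw, rfl⟩
  intro x hx n
  induction n generalizing x with
  | zero => simp
  | succ n ih =>
    constructor
    · rw [pow_succ', pow_succ]
      exact (congrArg T.adjoint (ih (hmap hx)).1).trans (h₁ x hx)
    · rw [pow_succ', pow_succ]
      exact (congrArg T (ih (h₂ x hx).1).2).trans (h₂ x hx).2

theorem norm_pow_apply_of_mem {T : H →L[ℂ] H} {x : H} (hx : x ∈ unitarySubspace T) (n : ℕ) :
    ‖(T ^ n) x‖ = ‖x‖ := by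
  have h : inner ℂ ((T ^ n) x) ((T ^ n) x) = inner ℂ x x := by
    rw [← adjoint_inner_left, ← star_eq_adjoint, star_pow, star_eq_adjoint, (hx n).1]
  rw [@norm_eq_sqrt_re_inner ℂ, @norm_eq_sqrt_re_inner ℂ _ _ _ _ x, h]

theorem mapsTo_unitarySubspace {T : H →L[ℂ] H} (hT : ‖T‖ ≤ 1) :
    Set.MapsTo T (unitarySubspace T) (unitarySubspace T) := by
  intro x hx
  have hiso (n : ℕ) : T.adjoint (T ((T ^ n) x)) = (T ^ n) x := by
    refine adjoint_apply_self_of_norm_eq hT ?_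
    rw [← pow_succ_apply', norm_pow_apply_of_mem hx, norm_pow_apply_of_mem hx]
  intro n
  constructor
  · induction n with
    | zero => simp
    | succ n ih =>
      rw [← pow_succ_apply, pow_succ_apply' T, pow_succ_apply T.adjoint, hiso, pow_succ_apply, ih]
  · cases n with
    | zero => simp
    | succ n =>
      rw [pow_succ_apply', pow_succ_apply, adjoint_apply_of_mem hx, (hx n).2]

theorem adjoint_mem_unitarySubspace {T : H →L[ℂ] H} (hT : ‖T‖ ≤ 1) {x : H}
    (hx : x ∈ unitarySubspace T) : T.adjoint x ∈ unitarySubspace T := by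
  have h := mapsTo_unitarySubspace (T := T.adjoint) (by simpa using hT)
  rw [unitarySubspace_adjoint] at h
  exact h hx

theorem reduces_unitarySubspace {T : H →L[ℂ] H} (hT : ‖T‖ ≤ 1) :
    Reduces T (unitarySubspace T) where
  mapsTo := mapsTo_unitarySubspace hT
  mapsTo_orthogonal := fun v hv u hu => by
    rw [← adjoint_inner_left]
    exact hv _ (adjoint_mem_unitarySubspace hT hu)

theorem isUnitary_restrict_unitarySubspace {T : H →L[ℂ] H} (hT : ‖T‖ ≤ 1) :
    IsUnitary (T.restrict (reduces_unitarySubspace hT).mapsTo) :=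
  (isUnitary_restrict_iff T _).2 ⟨fun _ hx => norm_apply_of_mem hx, fun x hx =>
    ⟨T.adjoint x, adjoint_mem_unitarySubspace hT hx, apply_adjoint_of_mem hx⟩⟩

theorem isUnitarySubspace_unitarySubspace {T : H →L[ℂ] H} (hT : ‖T‖ ≤ 1) :
    IsUnitarySubspace T (unitarySubspace T) where
  reduces := reduces_unitarySubspace hT
  isUnitary := isUnitary_restrict_unitarySubspace hT
  norm_le_one := (norm_restrict_le _ _).trans hT
  completelyNonunitary := by
    intro N _ hN hU
    obtain ⟨hnorm, hsurj⟩ := (isUnitary_restrict_iff _ _).1 hU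
    -- Seen inside `H`, `N` is mapped isometrically onto itself, so it lies in the unitary subspace
    -- as well as in its complement.
    have hle : N.map (unitarySubspace T)ᗮ.subtype ≤ unitarySubspace T := by
      refine le_unitarySubspace hT ?_ ?_ ?_
      · rintro _ ⟨v, hv, rfl⟩
        exact ⟨_, hN.mapsTo hv, rfl⟩
      · rintro _ ⟨v, hv, rfl⟩
        exact hnorm v hv
      · rintro _ ⟨v, hv, rfl⟩
        obtain ⟨w, hw, hwv⟩ := hsurj v hv
        exact ⟨w, ⟨w, hw, rfl⟩, congrArg Subtype.val hwv⟩
    rw [eq_bot_iff]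
    intro v hv
    have h := hle ⟨v, hv, rfl⟩
    exact (Submodule.mem_bot ℂ).2
      (Subtype.ext (inner_self_eq_zero (𝕜 := ℂ).1 (v.2 _ h)))

theorem IsUnitarySubspace.le_unitarySubspace {T : H →L[ℂ] H} (hT : ‖T‖ ≤ 1)
    {M : Submodule ℂ H} [CompleteSpace M] (hM : IsUnitarySubspace T M) :
    M ≤ unitarySubspace T :=
  have h := (isUnitary_restrict_iff T _).1 hM.isUnitary
  WeakDynamics.le_unitarySubspace hT hM.reduces.mapsTo h.1 h.2

theorem IsUnitarySubspace.eq_unitarySubspace {T : H →L[ℂ] H} (hT : ‖T‖ ≤ 1)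
    {M : Submodule ℂ H} [CompleteSpace M] (hM : IsUnitarySubspace T M) :
    M = unitarySubspace T := by
  refine le_antisymm (hM.le_unitarySubspace hT) fun x hx => ?_
  -- The part of the unitary subspace orthogonal to `M` reduces the completely nonunitary part to a
  -- unitary, hence is zero.
  let N : Submodule ℂ Mᗮ := (unitarySubspace T).comap Mᗮ.subtype
  have hNadj (v : Mᗮ) (hv : v ∈ N) : ∃ w ∈ N, (w : H) = T.adjoint v := by
    refine ⟨⟨T.adjoint v, fun u hu => ?_⟩, adjoint_mem_unitarySubspace hT hv, rfl⟩
    rw [adjoint_inner_right]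
    exact v.2 _ (hM.reduces.mapsTo hu)
  have hN : Reduces (T.restrict hM.reduces.mapsTo_orthogonal) N := by
    refine ⟨fun v hv => mapsTo_unitarySubspace hT hv, fun v hv u hu => ?_⟩
    obtain ⟨w, hw, hwu⟩ := hNadj u hu
    have h : inner ℂ (w : H) (v : H) = 0 := hv w hw
    rwa [hwu, adjoint_inner_left] at h
  have hclosed : IsClosed (N : Set Mᗮ) :=
    (completeSpace_coe_iff_isComplete.1 (completeSpace_unitarySubspace T)).isClosed.preimage
      continuous_subtype_val
  have : CompleteSpace N := hclosed.completeSpace_coe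
  have hbot : N = ⊥ := by
    refine hM.completelyNonunitary N hN ((isUnitary_restrict_iff _ _).2 ⟨?_, ?_⟩)
    · exact fun v hv => norm_apply_of_mem (x := (v : H)) hv
    · intro v hv
      obtain ⟨w, hw, hwv⟩ := hNadj v hv
      refine ⟨w, hw, Subtype.ext ?_⟩
      change T w = v
      rw [hwv]
      exact apply_adjoint_of_mem (x := (v : H)) hv
  obtain ⟨p, hp, q, hq, rfl⟩ := M.exists_add_mem_mem_orthogonal x
  have hqN : (⟨q, hq⟩ : Mᗮ) ∈ N := by
    have := sub_mem hx (hM.le_unitarySubspace hT hp)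
    rwa [add_sub_cancel_left] at this
  rw [hbot, Submodule.mem_bot] at hqN
  have hq0 : q = 0 := congrArg Subtype.val hqN
  simpa [hq0] using hp

/-! ### Weak limits of orbits -/

theorem tendsto_adjoint_pow_apply_sub {T : H →L[ℂ] H} (hT : ‖T‖ ≤ 1) (k : ℕ) (x : H) :
    Tendsto (fun n => (T.adjoint ^ k) ((T ^ k) ((T ^ n) x)) - (T ^ n) x) atTop (𝓝 0) := by
  have hanti : Antitone fun n => ‖(T ^ n) x‖ ^ 2 := by
    refine antitone_nat_of_succ_le fun n => ?_
    simp only [pow_succ_apply']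
    gcongr
    simpa using T.le_of_opNorm_le hT ((T ^ n) x)
  have hlim := tendsto_atTop_ciInf hanti ⟨0, by rintro _ ⟨n, rfl⟩; positivity⟩
  -- `‖Tⁿ x‖²` and its shift by `k` have the same limit; their difference bounds the squared norm in
  -- question.
  have hdiff := hlim.sub ((tendsto_add_atTop_iff_nat k).2 hlim)
  rw [sub_self] at hdiff
  have hTk : ‖T ^ k‖ ≤ 1 := opNorm_le_bound _ zero_le_one fun y => by
    simpa using norm_pow_apply_le hT k y
  have hsq : Tendsto (fun n => ‖(T.adjoint ^ k) ((T ^ k) ((T ^ n) x)) - (T ^ n) x‖ ^ 2)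
      atTop (𝓝 0) := by
    refine squeeze_zero (fun _ => sq_nonneg _) (fun n => ?_) hdiff
    have := norm_adjoint_apply_self_sub_sq_le hTk ((T ^ n) x)
    rw [← star_eq_adjoint, star_pow, star_eq_adjoint] at this
    rwa [add_comm n k, pow_add_apply]
  rw [tendsto_zero_iff_norm_tendsto_zero]
  simpa using hsq.sqrt

/-- Weak limits of the orbit of `x` along a free ultrafilter lie in the unitary subspace. -/
theorem weak_limit_mem_unitarySubspace {T : H →L[ℂ] H} (hT : ‖T‖ ≤ 1) {F : Ultrafilter ℕ}
    (hF : (F : Filter ℕ) ≤ atTop) {x y : H}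
    (hy : ∀ z, Tendsto (fun n => inner ℂ z ((T ^ n) x)) F (𝓝 (inner ℂ z y))) :
    y ∈ unitarySubspace T := by
  have adjoint_pow_inner (k : ℕ) (a b : H) : inner ℂ a ((T.adjoint ^ k) b) = inner ℂ ((T ^ k) a) b := by
    rw [← star_eq_adjoint, ← star_pow, star_eq_adjoint, adjoint_inner_right]
  have pow_inner (k : ℕ) (a b : H) : inner ℂ a ((T ^ k) b) = inner ℂ ((T.adjoint ^ k) a) b := by
    rw [← star_eq_adjoint, ← star_pow, star_eq_adjoint, adjoint_inner_left]
  have key (s : ℕ → ℕ) (hs : Tendsto s F atTop) (w : H)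
      (hw : ∀ z, Tendsto (fun n => inner ℂ z ((T ^ s n) x)) F (𝓝 (inner ℂ z w))) (k : ℕ) :
      (T.adjoint ^ k) ((T ^ k) w) = w := by
    refine ext_inner_left ℂ fun z => ?_
    have h₁ : Tendsto (fun n => inner ℂ z ((T.adjoint ^ k) ((T ^ k) ((T ^ s n) x)))) F
        (𝓝 (inner ℂ z ((T.adjoint ^ k) ((T ^ k) w)))) := by
      simpa only [adjoint_pow_inner, pow_inner] using hw ((T.adjoint ^ k) ((T ^ k) z))
    have h₂ : Tendsto (fun n => inner ℂ z
        ((T.adjoint ^ k) ((T ^ k) ((T ^ s n) x)) - (T ^ s n) x)) F (𝓝 (inner ℂ z (0 : H))) :=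
      tendsto_const_nhds.inner ((tendsto_adjoint_pow_apply_sub hT k x).comp hs)
    have h₃ := h₂.add (hw z)
    simp only [← inner_add_right, sub_add_cancel, zero_add] at h₃
    exact tendsto_nhds_unique h₁ h₃
  intro k
  refine ⟨key id hF y hy k, ?_⟩
  -- For the other identity, write `y = Tᵏ w` with `w` a weak limit of the orbit delayed by `k`, and
  -- apply `key` to `w`. Truncation in `n - k` is harmless as `n ≥ k` eventually along `F`.
  have hs : Tendsto (fun n => n - k) F atTop := (tendsto_sub_atTop_nat k).mono_left hF
  obtain ⟨w, hw⟩ := exists_weak_limit_of_bounded F (x := fun n => (T ^ (n - k)) x)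
    fun n => norm_pow_apply_le hT _ x
  have hwy : (T ^ k) w = y := by
    refine ext_inner_left ℂ fun z => tendsto_nhds_unique ?_ (hy z)
    rw [pow_inner]
    refine (hw ((T.adjoint ^ k) z)).congr' ?_
    filter_upwards [hF (eventually_ge_atTop k)] with n hn
    rw [← pow_inner, ← pow_add_apply, Nat.add_sub_cancel' hn]
  rw [← hwy, key _ hs w hw k]

theorem CompletelyNonunitary.weaklyStable {T : H →L[ℂ] H} (hT : ‖T‖ ≤ 1)
    (h : CompletelyNonunitary T) : WeaklyStable T := by
  intro x z
  rw [tendsto_iff_ultrafilter]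
  intro F hF
  obtain ⟨y, hy⟩ := exists_weak_limit_of_bounded F (x := fun n => (T ^ n) x)
    fun n => norm_pow_apply_le hT n x
  have hy0 := weak_limit_mem_unitarySubspace hT hF hy
  rw [h _ (reduces_unitarySubspace hT) (isUnitary_restrict_unitarySubspace hT),
    Submodule.mem_bot] at hy0
  rw [← hy0]
  exact hy z

theorem IsUnitarySubspace.weaklyStable_iff {T : H →L[ℂ] H} {M : Submodule ℂ H}
    [CompleteSpace M] (hM : IsUnitarySubspace T M) :
    WeaklyStable T ↔ WeaklyStable (T.restrict hM.reduces.mapsTo) := by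
  rw [weaklyStable_iff_of_reduces hM.reduces]
  exact and_iff_left (hM.completelyNonunitary.weaklyStable hM.norm_le_one)

/-! ### Finite-dimensional unitary parts -/

/-- If the unitary part of a supercyclic contraction is nonzero and acts on a finite-dimensional
space, then it is the whole operator. -/
theorem IsUnitarySubspace.finiteDimensional {T : H →L[ℂ] H} (hT : ‖T‖ ≤ 1)
    (hs : WeaklyLSeqSupercyclic T) {M : Submodule ℂ H} [CompleteSpace M]
    (hM : IsUnitarySubspace T M) (hne : M ≠ ⊥) [FiniteDimensional ℂ M] :
    FiniteDimensional ℂ H := by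
  obtain ⟨y, hy⟩ := hs
  have hp := (hy.orthogonalProjection hM.reduces hne).1
  have horth : Mᗮ = ⊥ := by
    rw [eq_bot_iff]
    intro x hx
    obtain ⟨α, -, n, -, hlim⟩ := hy.2 x
    have hproj := (hlim.orthogonalProjection M).tendsto_of_finiteDimensional.norm
    have hmem : (M.orthogonalProjectionOnto y : H) ∈ unitarySubspace T :=
      hM.le_unitarySubspace hT (M.orthogonalProjectionOnto y).2
    have hnorm (i : ℕ) : ‖M.orthogonalProjectionOnto (α i • (T ^ n i) y)‖ =
        ‖α i‖ * ‖M.orthogonalProjectionOnto y‖ := by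
      rw [map_smul, norm_smul, pow_orthogonalProjection_of_reduces hM.reduces]
      congr 1
      exact (congrArg norm (coe_restrict_pow T hM.reduces.mapsTo _ _)).trans
        (norm_pow_apply_of_mem hmem _)
    simp only [hnorm, Submodule.orthogonalProjectionOnto_apply_of_mem_orthogonal hx,
      norm_zero] at hproj
    -- Powers of `T` preserve the norm of the projection of `y`, so projections tending to 0 force
    -- the scalars to 0; the orbit of `y` being bounded, the whole sequence vanishes in the limit
    -- and `x = 0`.
    have hα : Tendsto (fun i => ‖α i‖) atTop (𝓝 0) := by
      have := hproj.div_const ‖M.orthogonalProjectionOnto y‖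
      simpa only [mul_div_cancel_right₀ _ (norm_ne_zero_iff.2 hp), zero_div] using this
    have hzero : Tendsto (fun i => α i • (T ^ n i) y) atTop (𝓝 0) := by
      refine squeeze_zero_norm (a := fun i => ‖α i‖ * ‖y‖) (fun i => ?_)
        (by simpa using hα.mul_const ‖y‖)
      rw [norm_smul]
      exact mul_le_mul_of_nonneg_left (norm_pow_apply_le hT _ _) (norm_nonneg _)
    have h0 := tendsto_nhds_unique (hlim x) (tendsto_const_nhds.inner hzero)
    rw [inner_zero_right] at h0
    exact inner_self_eq_zero (𝕜 := ℂ).1 h0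
  have htop : M = ⊤ := (Submodule.orthogonal_eq_bot_iff).1 horth
  subst htop
  exact Module.Finite.equiv (Submodule.topEquiv (R := ℂ) (M := H))

end Complete

end WeakDynamics

theorem mainTheorem3 :
    (∀ (H : Type u) [NormedAddCommGroup H] [InnerProductSpace ℂ H] [CompleteSpace H]
        (T : H →L[ℂ] H), ‖T‖ ≤ 1 →
      -- existence and uniqueness of the Nagy–Foiaş–Langer decomposition
      (∃! M : Submodule ℂ H, ∃ _ : CompleteSpace M, IsUnitarySubspace T M) ∧
      -- completely nonunitary contractions are weakly stable
      (CompletelyNonunitary T → WeaklyStable T) ∧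
      -- weak instability is carried by the unitary part
      (∀ (M : Submodule ℂ H) [CompleteSpace M] (hM : IsUnitarySubspace T M),
        (¬ WeaklyStable T ↔
          M ≠ ⊥ ∧ ¬ WeaklyStable (T.restrict hM.reduces.mapsTo)) ∧
        (¬ WeaklyStable T → ‖T‖ = 1 ∧ ‖T.restrict hM.reduces.mapsTo‖ = 1))) ∧
    -- the question for contractions is equivalent to the question for unitary operators
    ((∀ (H : Type u) [NormedAddCommGroup H] [InnerProductSpace ℂ H] [CompleteSpace H],
        ¬ FiniteDimensional ℂ H →
        ∀ T : H →L[ℂ] H, ‖T‖ ≤ 1 → WeaklyLSeqSupercyclic T → WeaklyStable T) ↔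
      (∀ (H : Type u) [NormedAddCommGroup H] [InnerProductSpace ℂ H] [CompleteSpace H],
        ¬ FiniteDimensional ℂ H →
        ∀ U : H →L[ℂ] H, IsUnitary U → WeaklyLSeqSupercyclic U → WeaklyStable U)) := by
  refine ⟨fun H _ _ _ T hT => ⟨?_, fun h => h.weaklyStable hT, fun M _ hM => ?_⟩, ?_, ?_⟩
  · refine ⟨unitarySubspace T, ⟨inferInstance, isUnitarySubspace_unitarySubspace hT⟩, ?_⟩
    rintro M ⟨_, hM⟩
    exact hM.eq_unitarySubspace hT
  · rw [hM.weaklyStable_iff]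
    exact ⟨⟨fun h => ⟨ne_bot_of_not_weaklyStable_restrict h, h⟩, fun h => h.2⟩,
      fun h => hM.norm_eq_one hT (ne_bot_of_not_weaklyStable_restrict h)⟩
  · intro h H _ _ _ hinf U hU
    refine h H hinf U (ContinuousLinearMap.opNorm_le_bound _ zero_le_one fun x => ?_)
    rw [((isUnitary_iff_norm_map_and_surjective U).1 hU).1 x, one_mul]
  · intro h H _ _ _ hinf T hT hs
    have hM := isUnitarySubspace_unitarySubspace hT
    by_contra hns
    rw [hM.weaklyStable_iff] at hns
    have hne := ne_bot_of_not_weaklyStable_restrict hns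
    -- Assertion (ii) needs an infinite-dimensional space, which
    -- `IsUnitarySubspace.finiteDimensional` supplies by contraposition.
    refine hns (h _ (fun hfin => hinf (hM.finiteDimensional hT hs hne)) _ hM.isUnitary ?_)
    obtain ⟨y, hy⟩ := hs
    exact ⟨_, hy.orthogonalProjection hM.reduces hne⟩
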